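/- Let $\mathbf K$ be $\mathbb R$ or $\mathbb C$, let $\Pi$ be a Banach space over $\mathbf K$ that is reflexive or separable, and let $\mu$ be a positive (countably additive, $[0,+\infty]$-valued) measure on a $\sigma$-algebra of subsets of a set $\Omega$. Write $\Pi'_\beta$ for the dual of $\Pi$ with its norm topology and $\Pi'_\sigma$ for the dual with its weak* topology. A $\Pi'_\beta$-measure is a finitely additive function $m$, with $m(\emptyset)=0$, from a ring of subsets of $\Omega$ into $\Pi'$. A function $y:\Omega\to\Pi'$ is simply measurable into $\Pi'_\sigma$ (or $\Pi'_\beta$) if it is the everywhere pointwise limit, in that topology, of a sequence of measurable functions with finitely many values that vanish outside sets of finite measure. It is Pettis into $\Pi'_\sigma$ if for every measurable $A$ there is exactly one $x\in\Pi'$ such that for every weak* continuous linear functional $u$ the function $u\circ y$ is integrable over $A$ with $\int_A u\circ y\,d\mu=u(x)$. (a) Suppose that $\mu(\Omega)<+\infty$ and that $m$ is a $\Pi'_\beta$-measure defined on all measurable sets with $\|m(A)\|\le\mu(A)$ for all measurable $A$. Then there are $y:\Omega\to\Pi'$ and a separable closed linear subspace $S$ of $\Pi'_\beta$ such that $y$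 is simply measurable and Pettis into $\Pi'_\sigma$, for all measurable $A$ and all $\xi\in\Pi$ the function $\eta\mapsto y(\eta)(\xi)$ is integrable over $A$ with $m(A)(\xi)=\int_A y(\eta)(\xi)\,d\mu(\eta)$, and, if $\Pi$ is reflexive, $y(\Omega)\subseteq S$ and $y$ is simply measurable into $\Pi'_\beta$. (b) Let $1\le q<+\infty$ and let $m$ be a $\Pi'_\beta$-measure defined on the measurable sets of finite measure. Suppose that $m$ is absolutely $\mu$-continuous, that is, for every neighbourhood $U$ of $0$ in $\Pi'_\beta$ there is $\delta>0$ such that $m(A)\in U$ for all measurable $A$ with $\mu(A)\le\delta$, and that $m$ has bounded $\mu$–$q$ variation, that is, for every bounded seminorm $\nu$ on $\Pi'_\beta$ there is $M\ge0$ with $\sum_{A\in\mathcal F}\mu(A)^{1-q}\,\nu(m(A))^q\le M$ for all finite disjoint families $\mathcal F$ of measurable sets of finite positive measure. Then there are a countable disjoint family $\mathcal A$ of measurable sets of finite positive measure and $y:\Omega\to\Pi'$, simply measurable into $\Pi'_\sigma$, such that 1. $y(\eta)=0$ for $\eta\notin\bigcup\mathcal A$; 2. $m(A)=0$ for every measurable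 $A$ of finite measure with $A\cap\bigcup\mathcal A=\emptyset$; 3. for every $A_1\in\mathcal A$, every measurable $A\subseteq A_1$ and every $\xi\in\Pi$, the function $\eta\mapsto y(\eta)(\xi)$ is integrable over $A$ and $m(A)(\xi)=\int_A y(\eta)(\xi)\,d\mu(\eta)$; 4. if $\Pi$ is reflexive, then $y$ is simply measurable into $\Pi'_\beta$. -/

import Mathlib

open MeasureTheory Filter Topology
open scoped ENNReal

/-- A normed space is reflexive when its canonical map into the strong bidual is onto. -/
def IsReflexiveSpace (𝕜 X : Type*) [RCLike 𝕜] [NormedAddCommGroup X] [NormedSpace 𝕜 X] : Prop :=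
  Function.Surjective (NormedSpace.inclusionInDoubleDual 𝕜 X)

/-- `m` is an `E`-measure with domain `𝓡`: the family `𝓡` contains the empty set and is closed
under unions and differences, and `m` is finitely additive on `𝓡` with `m ∅ = 0`.
(The values of `m` outside `𝓡` are irrelevant.) -/
structure IsVMeasure {Ω E : Type*} [AddCommGroup E]
    (𝓡 : Set (Set Ω)) (m : Set Ω → E) : Prop where
  empty_mem : ∅ ∈ 𝓡
  union_mem : ∀ A ∈ 𝓡, ∀ B ∈ 𝓡, A ∪ B ∈ 𝓡
  diff_mem : ∀ A ∈ 𝓡, ∀ B ∈ 𝓡, A \ B ∈ 𝓡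
  map_empty : m ∅ = 0
  map_union : ∀ A ∈ 𝓡, ∀ B ∈ 𝓡, Disjoint A B → m (A ∪ B) = m A + m B

/-- The `E`-measure `m` with domain `𝓡` is absolutely `μ`-continuous: for every neighbourhood `U`
of zero in `E` there is `δ > 0` such that every measurable `A` with `μ A ≤ δ` is in the domain
of `m` and has `m A ∈ U`. -/
structure IsAbsContVMeasure {Ω E : Type*} [MeasurableSpace Ω] (μ : Measure Ω)
    [AddCommGroup E] [TopologicalSpace E] (𝓡 : Set (Set Ω)) (m : Set Ω → E) : Prop where
  isVMeasure : IsVMeasure 𝓡 m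
  small : ∀ U ∈ 𝓝 (0 : E), ∃ δ : ℝ, 0 < δ ∧
    ∀ A, MeasurableSet A → μ A ≤ ENNReal.ofReal δ → A ∈ 𝓡 ∧ m A ∈ U

/-- A seminorm on a topological vector space is bounded if it is bounded on every
(von Neumann) bounded set. -/
def IsBoundedSeminorm {𝕜 E : Type*} [RCLike 𝕜] [AddCommGroup E] [Module 𝕜 E]
    [TopologicalSpace E] (p : Seminorm 𝕜 E) : Prop :=
  ∀ B : Set E, Bornology.IsVonNBounded 𝕜 B → BddAbove (p '' B)

/-- The `E`-measure `m` with domain `𝓡` has bounded `μ`-`q` variation: `1 ≤ q < ∞`, every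
measurable set of finite positive measure is in the domain, and for every bounded seminorm `p`
on `E` the sums `∑ (μ A)^(1-q) p(m A)^q` over finite disjoint families of measurable sets of
finite positive measure are bounded by a common constant. -/
structure HasBoundedVariation (𝕜 : Type*) {Ω E : Type*} [RCLike 𝕜] [MeasurableSpace Ω]
    (μ : Measure Ω) (q : ℝ) [AddCommGroup E] [Module 𝕜 E] [TopologicalSpace E]
    (𝓡 : Set (Set Ω)) (m : Set Ω → E) : Prop where
  one_le : 1 ≤ q
  isVMeasure : IsVMeasure 𝓡 m
  mem : ∀ A, MeasurableSet A → 0 < μ A → μ A < ∞ → A ∈ 𝓡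
  bounded : ∀ p : Seminorm 𝕜 E, IsBoundedSeminorm p → ∃ M : ℝ, 0 ≤ M ∧
    ∀ 𝒜 : Finset (Set Ω), (𝒜 : Set (Set Ω)).PairwiseDisjoint id →
      (∀ A ∈ 𝒜, MeasurableSet A ∧ 0 < μ A ∧ μ A < ∞) →
      ∑ A ∈ 𝒜, (μ.real A) ^ (1 - q) * (p (m A)) ^ q ≤ M

/-- `x` is a Pettis integral of `c` over `A`: every continuous linear functional `u` has `u ∘ c`
integrable over `A` with integral `u x`. -/
def HasPettisIntegral (𝕜 : Type*) {Ω E : Type*} [RCLike 𝕜] [MeasurableSpace Ω] (μ : Measure Ω)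
    [AddCommGroup E] [Module 𝕜 E] [TopologicalSpace E] (c : Ω → E) (A : Set Ω) (x : E) : Prop :=
  ∀ u : E →L[𝕜] 𝕜, IntegrableOn (fun η => u (c η)) A μ ∧ ∫ η in A, u (c η) ∂μ = u x

/-- `c` is Pettis: it has a unique Pettis integral over every measurable set. -/
def IsPettis (𝕜 : Type*) {Ω E : Type*} [RCLike 𝕜] [MeasurableSpace Ω] (μ : Measure Ω)
    [AddCommGroup E] [Module 𝕜 E] [TopologicalSpace E] (c : Ω → E) : Prop :=
  ∀ A, MeasurableSet A → ∃! x, HasPettisIntegral 𝕜 μ c A x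

/-- `x` is simply measurable: it is the everywhere pointwise limit of a sequence of simple
functions, i.e. of measurable functions with finitely many values that vanish off a set of
finite measure. -/
abbrev IsSimplyMeasurable {Ω E : Type*} [MeasurableSpace Ω] (μ : Measure Ω)
    [Zero E] [TopologicalSpace E] (x : Ω → E) : Prop :=
  FinStronglyMeasurable x μ

/-! For each vector `ξ` the scalar measure `m(·)(ξ)` has a Radon–Nikodym density. The difficulty is
to find one functional `y η` that represents these densities at `η` for all `ξ` at once. For a
sequence `D` of vectors, collect the densities into `G : Ω → ℕ → 𝕜`. Almost every `G η` lies in the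
support of the law of `G`, so it is a limit of averages of `m` evaluated along `D`. These averages
lie in a weak* compact set `C`, hence `G η` is the evaluation of a member of `C`
(`IsVMeasure.exists_density_seq`). If `D` separates `C`, evaluation embeds `C` in a metrizable
space, and inverting it yields `y`.

For separable `X`, take `D` dense and `C` a ball. For reflexive `X`, the range of `m` is norm
separable: weak convergence of vectors gives pointwise, then `L¹`, convergence of densities, so the
unit ball is totally bounded for `sup_A ‖m A ξ‖` (`IsReflexiveSpace.exists_finset_approx`). Then `C`
is a ball of the closed span of the range, separated by countably many vectors.

In (b), bounded variation puts a nonnull set with `‖m A‖ ≤ n * μ.real A` for its measurable subsets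
`A` inside every nonnull set of finite measure. A maximal disjoint family of such sets with `m B ≠
0` is countable. Part (a) applies on each member, and absolute continuity makes `m` vanish off the
union. -/

/-! ### Reflexivity, weak* compactness and separating sequences. -/

section FunctionalAnalysis

variable {𝕜 X : Type*} [RCLike 𝕜] [NormedAddCommGroup X] [NormedSpace 𝕜 X]

/-- A separable subspace of the dual is separated by countably many vectors. -/
lemma exists_seq_separating_of_isSeparable {S : Submodule 𝕜 (StrongDual 𝕜 X)}
    (hS : TopologicalSpace.IsSeparable (S : Set (StrongDual 𝕜 X))) :
    ∃ D : ℕ → X, ∀ s ∈ S, (∀ n, s (D n) = 0) → s = 0 := by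
  have : TopologicalSpace.SeparableSpace S := hS.separableSpace
  have key : ∀ f : StrongDual 𝕜 X, ∃ ξ : X, ‖ξ‖ ≤ 1 ∧ ‖f‖ / 2 ≤ ‖f ξ‖ := by
    intro f
    by_cases hf : f = 0
    · exact ⟨0, by simp [hf]⟩
    · have hpos : 0 < ‖f‖ := norm_pos_iff.2 hf
      obtain ⟨ξ, h1, h2⟩ := f.exists_lt_apply_of_lt_opNorm (r := ‖f‖ / 2) (by linarith)
      exact ⟨ξ, h1.le, h2.le⟩
  choose ξ hξ1 hξ2 using key
  refine ⟨fun n => ξ (TopologicalSpace.denseSeq S n), fun s hs h0 => ?_⟩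
  by_contra hne
  have hpos : 0 < ‖s‖ := norm_pos_iff.2 hne
  -- If `s` vanishes on all the almost norming vectors, a dense element `t` within `‖s‖ / 4` has
  -- `‖t‖ / 2 < ‖s‖ / 4`, whereas closeness forces `‖t‖ > 3 * ‖s‖ / 4`.
  obtain ⟨n, hn⟩ := Metric.denseRange_iff.1 (TopologicalSpace.denseRange_denseSeq S) ⟨s, hs⟩
    (‖s‖ / 4) (by linarith)
  set t : StrongDual 𝕜 X := (TopologicalSpace.denseSeq S n : StrongDual 𝕜 X) with ht
  have hd : ‖s - t‖ < ‖s‖ / 4 := by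
    rw [← dist_eq_norm]; exact hn
  have h1 : ‖t (ξ t)‖ ≤ ‖s - t‖ := by
    have : t (ξ t) = - (s - t) (ξ t) := by
      have h : s (ξ t) = 0 := h0 n
      simp [h]
    rw [this, norm_neg]
    calc _ ≤ ‖s - t‖ * ‖ξ t‖ := (s - t).le_opNorm _
      _ ≤ ‖s - t‖ * 1 := by gcongr; exact hξ1 t
      _ = _ := mul_one _
  have h2 := hξ2 t
  have h3 := norm_sub_norm_le s t
  linarith

/-- Restricting `u` to the canonical image of `X` gives the representing functional; nothing is lost
because that image is the whole bidual. -/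
lemma IsReflexiveSpace.dual (hX : IsReflexiveSpace 𝕜 X) :
    IsReflexiveSpace 𝕜 (StrongDual 𝕜 X) := by
  intro u
  refine ⟨u.comp (NormedSpace.inclusionInDoubleDual 𝕜 X), ?_⟩
  ext v
  obtain ⟨x, rfl⟩ := hX v
  simp [NormedSpace.dual_def]

/-- A closed subspace and a point outside it are separated by a functional vanishing on the
subspace. -/
lemma Submodule.exists_dual_vanishing_of_notMem {S : Submodule 𝕜 X} (hS : IsClosed (S : Set X))
    {v : X} (hv : v ∉ S) : ∃ g : StrongDual 𝕜 X, (∀ s ∈ S, g s = 0) ∧ g v ≠ 0 := by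
  have hne : ‖S.mkQ v‖ ≠ 0 := by
    refine mt (QuotientAddGroup.norm_mk_eq_zero_iff_mem_closure (S := S.toAddSubgroup)).1 ?_
    rwa [Submodule.coe_toAddSubgroup, hS.closure_eq]
  obtain ⟨g, -, hg⟩ := exists_dual_vector 𝕜 (S.mkQ v) hne
  refine ⟨g.comp S.mkQL, fun s hs => ?_, fun h0 => ?_⟩
  · change g (S.mkQ s) = 0
    rw [Submodule.mkQ_apply, (Submodule.Quotient.mk_eq_zero S).2 hs, map_zero]
  · have h1 : g (S.mkQ v) = 0 := h0
    rw [hg] at h1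
    exact hne (by exact_mod_cast h1)

/-- In the dual of a reflexive space, norm-closed subspaces are weak* closed. -/
lemma IsReflexiveSpace.isClosed_weakDual (hX : IsReflexiveSpace 𝕜 X)
    {S : Submodule 𝕜 (StrongDual 𝕜 X)} (hS : IsClosed (S : Set (StrongDual 𝕜 X))) :
    IsClosed (WeakDual.toStrongDual ⁻¹' (S : Set (StrongDual 𝕜 X))) := by
  -- `S` is its own double annihilator: the separating functional from Hahn–Banach is, by
  -- reflexivity, evaluation at a vector, hence weak* continuous.
  have : WeakDual.toStrongDual ⁻¹' (S : Set (StrongDual 𝕜 X)) =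
      ⋂ x ∈ {x : X | ∀ s ∈ S, s x = 0}, {s : WeakDual 𝕜 X | s x = 0} := by
    ext s
    simp only [Set.mem_preimage, SetLike.mem_coe, Set.mem_iInter, Set.mem_ofPred_eq]
    refine ⟨fun h x hx => hx _ h, fun h => ?_⟩
    by_contra hs
    obtain ⟨g, hg0, hg⟩ := Submodule.exists_dual_vanishing_of_notMem hS hs
    obtain ⟨x, rfl⟩ := hX g
    exact hg (h x hg0)
  rw [this]
  exact isClosed_biInter fun x _ => isClosed_eq (WeakDual.eval_continuous x) continuous_const

lemma IsReflexiveSpace.isCompact_inter_closedBall (hX : IsReflexiveSpace 𝕜 X)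
    {S : Submodule 𝕜 (StrongDual 𝕜 X)} (hS : IsClosed (S : Set (StrongDual 𝕜 X))) (r : ℝ) :
    IsCompact (WeakDual.toStrongDual ⁻¹' ((S : Set (StrongDual 𝕜 X)) ∩ Metric.closedBall 0 r)) :=
  (WeakDual.isCompact_closedBall (𝕜 := 𝕜) (E := X) 0 r).inter_left (hX.isClosed_weakDual hS)

variable (𝕜) in
/-- Evaluation of weak* functionals along a sequence of vectors. -/
noncomputable def weakDualEvalSeq (D : ℕ → X) (s : WeakDual 𝕜 X) : ℕ → 𝕜 := fun n => s (D n)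

lemma continuous_weakDualEvalSeq (D : ℕ → X) : Continuous (weakDualEvalSeq 𝕜 D) :=
  continuous_pi fun n => WeakDual.eval_continuous (D n)

/-- Bounded sequences in the dual of a reflexive space have weak* convergent subsequences. -/
lemma IsReflexiveSpace.exists_subseq_tendsto (hX : IsReflexiveSpace 𝕜 X)
    (s : ℕ → StrongDual 𝕜 X) {r : ℝ} (hs : ∀ n, ‖s n‖ ≤ r) :
    ∃ (φ : ℕ → ℕ) (t : StrongDual 𝕜 X), StrictMono φ ∧
      ∀ x, Tendsto (fun n => s (φ n) x) atTop (𝓝 (t x)) := by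
  -- Inside the separable closed span, bounded weak* compact sets embed in the metrizable space `ℕ →
  -- 𝕜`, so compactness gives subsequences.
  set S := (Submodule.span 𝕜 (Set.range s)).topologicalClosure with hSdef
  have hSc : IsClosed (S : Set (StrongDual 𝕜 X)) := Submodule.isClosed_topologicalClosure _
  have hSs : TopologicalSpace.IsSeparable (S : Set (StrongDual 𝕜 X)) := by
    rw [hSdef, Submodule.topologicalClosure_coe]
    exact ((Set.countable_range s).isSeparable.span (R := 𝕜)).closure
  obtain ⟨D, hD⟩ := exists_seq_separating_of_isSeparable hSs
  set K : Set (WeakDual 𝕜 X) :=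
    WeakDual.toStrongDual ⁻¹' ((S : Set (StrongDual 𝕜 X)) ∩ Metric.closedBall 0 r) with hK
  have hKc : IsCompact K := hX.isCompact_inter_closedBall hSc r
  have : CompactSpace K := isCompact_iff_compactSpace.1 hKc
  have hcont : Continuous fun k : K => weakDualEvalSeq 𝕜 D k :=
    (continuous_weakDualEvalSeq D).comp continuous_subtype_val
  have hinj : Function.Injective fun k : K => weakDualEvalSeq 𝕜 D k := by
    intro a b hab
    have : WeakDual.toStrongDual (a : WeakDual 𝕜 X) - WeakDual.toStrongDual (b : WeakDual 𝕜 X) = 0 :=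
      hD _ (S.sub_mem a.2.1 b.2.1) fun n => by
        have := congrFun hab n
        simpa [sub_eq_zero, weakDualEvalSeq] using this
    exact Subtype.ext (WeakDual.toStrongDual.injective (sub_eq_zero.1 this))
  have hemb := hcont.isClosedEmbedding hinj
  have hmem : ∀ n, StrongDual.toWeakDual (s n) ∈ K := fun n =>
    ⟨Submodule.le_topologicalClosure _ (Submodule.subset_span ⟨n, rfl⟩), by simpa using hs n⟩
  obtain ⟨z, ⟨k, rfl⟩, φ, hφ, hlim⟩ := (isCompact_range hcont).isSeqCompact
    (x := fun n => weakDualEvalSeq 𝕜 D (⟨_, hmem n⟩ : K)) fun n => ⟨⟨_, hmem n⟩, rfl⟩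
  have hlim' : Tendsto (fun n => (⟨_, hmem (φ n)⟩ : K)) atTop (𝓝 k) :=
    hemb.isInducing.tendsto_nhds_iff.2 hlim
  refine ⟨φ, WeakDual.toStrongDual (k : WeakDual 𝕜 X), hφ, fun x => ?_⟩
  exact (((WeakDual.eval_continuous x).comp continuous_subtype_val).tendsto k).comp hlim'

/-- Bounded sequences in a reflexive space have weakly convergent subsequences. -/
lemma IsReflexiveSpace.exists_subseq_tendsto_apply (hX : IsReflexiveSpace 𝕜 X)
    (ξ : ℕ → X) {r : ℝ} (hξ : ∀ n, ‖ξ n‖ ≤ r) :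
    ∃ (φ : ℕ → ℕ) (x : X), StrictMono φ ∧
      ∀ f : StrongDual 𝕜 X, Tendsto (fun n => f (ξ (φ n))) atTop (𝓝 (f x)) := by
  obtain ⟨φ, t, hφ, ht⟩ := hX.dual.exists_subseq_tendsto
    (fun n => NormedSpace.inclusionInDoubleDual 𝕜 X (ξ n))
    fun n => (NormedSpace.double_dual_bound 𝕜 X _).trans (hξ n)
  obtain ⟨x, rfl⟩ := hX t
  exact ⟨φ, x, hφ, fun f => by simpa [NormedSpace.dual_def] using ht f⟩

end FunctionalAnalysis

/-! ### Finitely additive set functions on rings. -/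

section FinitelyAdditive

variable {Ω E : Type*} [AddCommGroup E] {𝓡 : Set (Set Ω)} {m : Set Ω → E}

lemma IsVMeasure.map_diff (hm : IsVMeasure 𝓡 m) {A B : Set Ω} (hA : A ∈ 𝓡) (hB : B ∈ 𝓡)
    (h : B ⊆ A) : m (A \ B) = m A - m B := by
  have := hm.map_union _ (hm.diff_mem A hA B hB) B hB Set.disjoint_sdiff_left
  rw [Set.sdiff_union_of_subset h] at this
  rw [this, add_sub_cancel_right]

lemma IsVMeasure.biUnion_mem (hm : IsVMeasure 𝓡 m) {ι : Type*} (s : Finset ι) (f : ι → Set Ω)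
    (hf : ∀ i ∈ s, f i ∈ 𝓡) : (⋃ i ∈ s, f i) ∈ 𝓡 := by
  classical
  induction s using Finset.induction_on with
  | empty => simpa using hm.empty_mem
  | insert a s ha ih =>
    rw [Finset.set_biUnion_insert]
    exact hm.union_mem _ (hf a (by simp)) _ (ih fun i hi => hf i (by simp [hi]))

lemma IsVMeasure.map_biUnion (hm : IsVMeasure 𝓡 m) {ι : Type*} (s : Finset ι) (f : ι → Set Ω)
    (hf : ∀ i ∈ s, f i ∈ 𝓡) (hd : (s : Set ι).PairwiseDisjoint f) :
    m (⋃ i ∈ s, f i) = ∑ i ∈ s, m (f i) := by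
  classical
  induction s using Finset.induction_on with
  | empty => simpa using hm.map_empty
  | insert a s ha ih =>
    have hs : ∀ i ∈ s, f i ∈ 𝓡 := fun i hi => hf i (by simp [hi])
    rw [Finset.set_biUnion_insert, Finset.sum_insert ha,
      hm.map_union _ (hf a (by simp)) _ (hm.biUnion_mem s f hs),
      ih hs (hd.subset (by simp))]
    refine Set.disjoint_iUnion₂_right.2 fun i hi => ?_
    exact hd (by simp) (by simp [hi]) (by rintro rfl; exact ha hi)

lemma IsVMeasure.map {F : Type*} [AddCommGroup F] (hm : IsVMeasure 𝓡 m) (L : E →+ F) :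
    IsVMeasure 𝓡 (fun A => L (m A)) where
  empty_mem := hm.empty_mem
  union_mem := hm.union_mem
  diff_mem := hm.diff_mem
  map_empty := by simp [hm.map_empty]
  map_union A hA B hB h := by simp [hm.map_union A hA B hB h]

end FinitelyAdditive

/-! ### Scalar densities. -/

section RadonNikodym

variable {Ω : Type*} [MeasurableSpace Ω] {μ : Measure Ω}

/-- A finitely additive real set function dominated by a finite measure has a density. -/
lemma IsVMeasure.exists_density_real [IsFiniteMeasure μ] {m : Set Ω → ℝ}
    (hm : IsVMeasure {A | MeasurableSet A} m) {c : ℝ}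
    (hb : ∀ A, MeasurableSet A → |m A| ≤ c * μ.real A) :
    ∃ f : Ω → ℝ, Measurable f ∧ Integrable f μ ∧ ∀ A, MeasurableSet A → ∫ η in A, f η ∂μ = m A := by
  classical
  -- Domination upgrades finite to countable additivity: the tails of `m` are bounded by `c` times
  -- the tails of `μ`.
  have hσ : ∀ f : ℕ → Set Ω, (∀ i, MeasurableSet (f i)) → Pairwise (Function.onFun Disjoint f) →
      HasSum (fun i => m (f i)) (m (⋃ i, f i)) := by
    intro f hf hd
    have hμ : HasSum (fun i => μ.real (f i)) (μ.real (⋃ i, f i)) := by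
      have := μ.toSignedMeasure.m_iUnion hf hd
      simpa [Measure.toSignedMeasure_apply_measurable, hf, MeasurableSet.iUnion hf] using this
    have hs : Summable fun i => m (f i) :=
      Summable.of_norm_bounded (hμ.summable.mul_left c) fun i => hb _ (hf i)
    rw [hs.hasSum_iff_tendsto_nat]
    have hU : ∀ n, MeasurableSet (⋃ i ∈ Finset.range n, f i) := fun n =>
      Finset.measurableSet_biUnion _ fun i _ => hf i
    have hsub : ∀ n, (⋃ i ∈ Finset.range n, f i) ⊆ ⋃ i, f i := fun n =>
      Set.iUnion₂_subset fun i _ => Set.subset_iUnion f i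
    have hlim : Tendsto (fun n => c * (μ.real (⋃ i, f i) - ∑ i ∈ Finset.range n, μ.real (f i)))
        atTop (𝓝 0) := by
      have := (hμ.tendsto_sum_nat.const_sub (μ.real (⋃ i, f i))).const_mul c
      simpa using this
    rw [tendsto_iff_norm_sub_tendsto_zero]
    refine squeeze_zero (fun _ => norm_nonneg _) (fun n => ?_) hlim
    have h1 : m (⋃ i ∈ Finset.range n, f i) = ∑ i ∈ Finset.range n, m (f i) :=
      hm.map_biUnion _ _ (fun i _ => hf i) fun i _ j _ hij => hd hij
    have h2 : μ.real (⋃ i ∈ Finset.range n, f i) = ∑ i ∈ Finset.range n, μ.real (f i) :=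
      measureReal_biUnion_finset (fun i _ j _ hij => hd hij) fun i _ => hf i
    rw [← h1, ← h2, norm_sub_rev, ← hm.map_diff (MeasurableSet.iUnion hf) (hU n) (hsub n),
      ← measureReal_sdiff (hsub n) (hU n)]
    exact hb _ ((MeasurableSet.iUnion hf).diff (hU n))
  let s : SignedMeasure Ω :=
    { measureOf' := fun A => if MeasurableSet A then m A else 0
      empty' := by simp [hm.map_empty]
      not_measurable' := fun A hA => by simp [hA]
      m_iUnion' := fun f hf hd => by
        simpa [hf, MeasurableSet.iUnion hf] using hσ f hf hd }
  have hs : ∀ A, MeasurableSet A → s A = m A := fun A hA => if_pos hA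
  have hac : VectorMeasure.AbsolutelyContinuous s μ.toENNRealVectorMeasure := by
    refine VectorMeasure.AbsolutelyContinuous.mk fun A hA h0 => ?_
    rw [Measure.toENNRealVectorMeasure_apply_measurable hA] at h0
    rw [hs A hA]
    have := hb A hA
    simpa [measureReal_def, h0] using this
  refine ⟨s.rnDeriv μ, SignedMeasure.measurable_rnDeriv s μ, SignedMeasure.integrable_rnDeriv s μ,
    fun A hA => ?_⟩
  rw [← hs A hA, ← withDensityᵥ_apply (SignedMeasure.integrable_rnDeriv s μ) hA,
    SignedMeasure.withDensityᵥ_rnDeriv_eq s μ hac]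

variable {𝕜 : Type*} [RCLike 𝕜]

/-- A finitely additive scalar set function dominated by a finite measure has a density. -/
lemma IsVMeasure.exists_density_scalar [IsFiniteMeasure μ] {m : Set Ω → 𝕜}
    (hm : IsVMeasure {A | MeasurableSet A} m) {c : ℝ}
    (hb : ∀ A, MeasurableSet A → ‖m A‖ ≤ c * μ.real A) :
    ∃ f : Ω → 𝕜, Measurable f ∧ Integrable f μ ∧
      ∀ A, MeasurableSet A → ∫ η in A, f η ∂μ = m A := by
  obtain ⟨f, hf, hfi, hfm⟩ := (hm.map (RCLike.re : 𝕜 →+ ℝ)).exists_density_real (c := c)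
    fun A hA => (RCLike.abs_re_le_norm _).trans (hb A hA)
  obtain ⟨g, hg, hgi, hgm⟩ := (hm.map (RCLike.im : 𝕜 →+ ℝ)).exists_density_real (c := c)
    fun A hA => (RCLike.abs_im_le_norm _).trans (hb A hA)
  refine ⟨fun η => (f η : 𝕜) + (g η : 𝕜) * RCLike.I, by fun_prop,
    hfi.ofReal.add (hgi.ofReal.mul_const _), fun A hA => ?_⟩
  change ∫ η in A, ((f η : 𝕜) + (g η : 𝕜) * RCLike.I) ∂μ = m A
  rw [integral_add (Integrable.integrableOn hfi.ofReal).integrable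
    ((hgi.ofReal.mul_const _).integrableOn).integrable, integral_mul_const, integral_ofReal, integral_ofReal, hfm A hA, hgm A hA]
  exact RCLike.re_add_im _

end RadonNikodym

/-! ### Simultaneous densities along a sequence of vectors. -/

section Density

variable {Ω 𝕜 X : Type*} [MeasurableSpace Ω] [RCLike 𝕜]
  [NormedAddCommGroup X] [NormedSpace 𝕜 X] {μ : Measure Ω} {m : Set Ω → StrongDual 𝕜 X}

/-- If the averages of `m` lie in a weak* compact set `C`, then along each sequence of vectors
`m` has a density that is represented by elements of `C`. -/
lemma IsVMeasure.exists_density_seq [IsFiniteMeasure μ]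
    (hm : IsVMeasure {A | MeasurableSet A} m) {c : ℝ}
    (hb : ∀ A, MeasurableSet A → ‖m A‖ ≤ c * μ.real A)
    {C : Set (WeakDual 𝕜 X)} (hC : IsCompact C) (hC0 : 0 ∈ C)
    (hmC : ∀ A, MeasurableSet A → 0 < μ A →
      StrongDual.toWeakDual (((μ.real A)⁻¹ : 𝕜) • m A) ∈ C) (D : ℕ → X) :
    ∃ F : Ω → ℕ → 𝕜, Measurable F ∧ (∀ η, F η ∈ weakDualEvalSeq 𝕜 D '' C) ∧
      ∀ n, Integrable (fun η => F η n) μ ∧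
        ∀ A, MeasurableSet A → ∫ η in A, F η n ∂μ = m A (D n) := by
  classical
  have key : ∀ n, ∃ f : Ω → 𝕜, Measurable f ∧ Integrable f μ ∧
      ∀ A, MeasurableSet A → ∫ η in A, f η ∂μ = m A (D n) := fun n =>
    (hm.map (NormedSpace.inclusionInDoubleDual 𝕜 X (D n)).toLinearMap.toAddMonoidHom
      ).exists_density_scalar (c := c * ‖D n‖) fun A hA => by
        calc ‖m A (D n)‖ ≤ ‖m A‖ * ‖D n‖ := (m A).le_opNorm _
          _ ≤ c * μ.real A * ‖D n‖ := by gcongr; exact hb A hA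
          _ = _ := by ring
  choose f hf hfi hfm using key
  set G : Ω → ℕ → 𝕜 := fun η n => f n η with hG
  have hGm : Measurable G := measurable_pi_lambda _ hf
  set K : Set (ℕ → 𝕜) := weakDualEvalSeq 𝕜 D '' C with hK
  have hKc : IsClosed K := (hC.image (continuous_weakDualEvalSeq D)).isClosed
  have h0K : (0 : ℕ → 𝕜) ∈ K := ⟨0, hC0, by ext n; rfl⟩
  -- At a point of the support of `μ.map G`, every basic neighbourhood `V` has a preimage of
  -- positive measure. The average of `m` over it is within `ε i / 2` of `G η` in the finitely many
  -- constrained coordinates.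
  have hae : ∀ᵐ η ∂μ, G η ∈ K := by
    have hsupp : ∀ᵐ η ∂μ, G η ∈ (μ.map G).support :=
      ae_of_ae_map hGm.aemeasurable Measure.support_mem_ae
    filter_upwards [hsupp] with η hη
    rw [← hKc.closure_eq, mem_closure_iff_nhds]
    intro U hU
    rw [nhds_pi, Filter.mem_pi] at hU
    obtain ⟨I, hI, t, ht, htU⟩ := hU
    choose ε hε hεt using fun i => Metric.mem_nhds_iff.1 (ht i)
    set V : Set (ℕ → 𝕜) := I.pi fun i => Metric.ball (G η i) (ε i / 2) with hV
    have hVo : IsOpen V := isOpen_set_pi hI fun i _ => Metric.isOpen_ball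
    have hVη : V ∈ 𝓝 (G η) := hVo.mem_nhds fun i _ => Metric.mem_ball_self (by have := hε i; linarith)
    have hpos : 0 < μ (G ⁻¹' V) := by
      rw [← Measure.map_apply hGm hVo.measurableSet]
      exact (Measure.mem_support_iff_forall _).1 hη V hVη
    have hA : MeasurableSet (G ⁻¹' V) := hGm hVo.measurableSet
    have hposr : 0 < μ.real (G ⁻¹' V) := ENNReal.toReal_pos hpos.ne' (measure_ne_top _ _)
    refine ⟨_, htU ?_, _, hmC _ hA hpos, rfl⟩
    intro i hi
    refine hεt i ?_
    change ((μ.real (G ⁻¹' V) : 𝕜)⁻¹ • m (G ⁻¹' V)) (D i) ∈ Metric.ball (f i η) (ε i)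
    rw [Metric.mem_ball, dist_eq_norm, smul_apply, ← hfm i _ hA]
    have hne : (μ.real (G ⁻¹' V) : 𝕜) ≠ 0 := by exact_mod_cast hposr.ne'
    have h1 : (μ.real (G ⁻¹' V) : 𝕜)⁻¹ • ∫ η in G ⁻¹' V, f i η ∂μ - f i η =
        (μ.real (G ⁻¹' V) : 𝕜)⁻¹ • ∫ ζ in G ⁻¹' V, (f i ζ - f i η) ∂μ := by
      rw [integral_sub (hfi i).integrableOn (integrable_const _), setIntegral_const,
        smul_sub, RCLike.real_smul_eq_coe_mul, smul_eq_mul, smul_eq_mul, inv_mul_cancel_left₀ hne]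
    rw [h1, norm_smul, norm_inv, RCLike.norm_ofReal, abs_of_pos hposr]
    have h2 : ‖∫ ζ in G ⁻¹' V, (f i ζ - f i η) ∂μ‖ ≤ ε i / 2 * μ.real (G ⁻¹' V) :=
      norm_setIntegral_le_of_norm_le_const (measure_lt_top _ _) fun ζ hζ => by
        rw [← dist_eq_norm]; exact (Metric.mem_ball.1 (hζ i hi)).le
    calc _ ≤ (μ.real (G ⁻¹' V))⁻¹ * (ε i / 2 * μ.real (G ⁻¹' V)) := by gcongr
      _ = ε i / 2 := by field_simp
      _ < ε i := by have := hε i; linarith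
  have hgood : MeasurableSet (G ⁻¹' K) := hGm hKc.measurableSet
  -- The value `0 ∈ K` on the exceptional null set makes membership hold everywhere.
  refine ⟨fun η => if η ∈ G ⁻¹' K then G η else 0, hGm.ite hgood measurable_const, fun η => ?_,
    fun n => ?_⟩
  · dsimp only
    split_ifs with h
    exacts [h, h0K]
  · have hEq : (fun η => (if η ∈ G ⁻¹' K then G η else 0) n) =ᵐ[μ] f n := by
      filter_upwards [hae] with η hη
      rw [if_pos (Set.mem_preimage.2 hη)]
    refine ⟨(hfi n).congr hEq.symm, fun A hA => ?_⟩
    rw [← hfm n A hA]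
    exact integral_congr_ae (ae_restrict_of_ae hEq)

end Density

/-- A functional vanishing on `S` commutes with the integral, so Hahn–Banach cannot separate the
integral from `S`. -/
lemma integral_mem_of_isClosed {Ω 𝕜 E : Type*} [MeasurableSpace Ω] [RCLike 𝕜]
    [NormedAddCommGroup E] [NormedSpace ℝ E] [NormedSpace 𝕜 E] [CompleteSpace E]
    {μ : Measure Ω} {S : Submodule 𝕜 E} (hS : IsClosed (S : Set E))
    {f : Ω → E} (hf : Integrable f μ) (hfS : ∀ η, f η ∈ S) : ∫ η, f η ∂μ ∈ S := by
  by_contra hI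
  obtain ⟨g, hg0, hg⟩ := Submodule.exists_dual_vanishing_of_notMem hS hI
  have h1 := g.integral_comp_comm hf
  simp only [fun η => hg0 _ (hfS η), integral_zero] at h1
  exact hg h1.symm

/-! ### Vector densities of dominated measures. -/

section DominatedDensity

variable {Ω 𝕜 X : Type*} [MeasurableSpace Ω] [RCLike 𝕜]
  [NormedAddCommGroup X] [NormedSpace 𝕜 X] {μ : Measure Ω} {m : Set Ω → StrongDual 𝕜 X}

lemma norm_inv_smul_le_of_le_mul {v : StrongDual 𝕜 X} {c t : ℝ} (ht : 0 < t)
    (h : ‖v‖ ≤ c * t) : ‖((t : 𝕜)⁻¹ : 𝕜) • v‖ ≤ c := by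
  rw [norm_smul, norm_inv, RCLike.norm_ofReal, abs_of_pos ht, inv_mul_le_iff₀ ht, mul_comm]
  exact h

/-- Averages of a dominated measure lie in the corresponding closed ball. -/
lemma average_mem_closedBall [IsFiniteMeasure μ] {c : ℝ}
    (hb : ∀ A, MeasurableSet A → ‖m A‖ ≤ c * μ.real A) {A : Set Ω} (hA : MeasurableSet A)
    (h0 : 0 < μ A) : (((μ.real A : 𝕜)⁻¹ : 𝕜) • m A) ∈ Metric.closedBall 0 c := by
  rw [mem_closedBall_zero_iff]
  exact norm_inv_smul_le_of_le_mul (ENNReal.toReal_pos h0.ne' (measure_ne_top _ _)) (hb A hA)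

/-- If moreover the sequence separates the points of `C`, the density along the sequence is
given by a weak* strongly measurable function into `C`. -/
lemma IsVMeasure.exists_weakDual_density_seq [IsFiniteMeasure μ]
    (hm : IsVMeasure {A | MeasurableSet A} m) {c : ℝ}
    (hb : ∀ A, MeasurableSet A → ‖m A‖ ≤ c * μ.real A)
    {C : Set (WeakDual 𝕜 X)} (hC : IsCompact C) (hC0 : 0 ∈ C)
    (hmC : ∀ A, MeasurableSet A → 0 < μ A →
      StrongDual.toWeakDual (((μ.real A)⁻¹ : 𝕜) • m A) ∈ C)
    {D : ℕ → X} (hD : Set.InjOn (weakDualEvalSeq 𝕜 D) C) :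
    ∃ y : Ω → StrongDual 𝕜 X, StronglyMeasurable (fun η => StrongDual.toWeakDual (y η)) ∧
      (∀ η, StrongDual.toWeakDual (y η) ∈ C) ∧
      ∀ n, ∀ A, MeasurableSet A → ∫ η in A, y η (D n) ∂μ = m A (D n) := by
  obtain ⟨F, hF, hFC, hFm⟩ := hm.exists_density_seq hb hC hC0 hmC D
  have : CompactSpace C := isCompact_iff_compactSpace.1 hC
  have hcont : Continuous fun k : C => weakDualEvalSeq 𝕜 D k :=
    (continuous_weakDualEvalSeq D).comp continuous_subtype_val
  -- A continuous injection of a compact space into a Hausdorff one has a continuous inverse on its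
  -- image; composing it with `F` gives `y`.
  have hemb := hcont.isClosedEmbedding hD.injective
  have hFr : ∀ η, F η ∈ Set.range fun k : C => weakDualEvalSeq 𝕜 D k := fun η => by
    obtain ⟨s, hs, h⟩ := hFC η
    exact ⟨⟨s, hs⟩, h⟩
  have hsm : StronglyMeasurable fun η =>
      (hemb.isEmbedding.toHomeomorph.symm ⟨F η, hFr η⟩ : C) :=
    hemb.isEmbedding.toHomeomorph.symm.continuous.comp_stronglyMeasurable
      (hF.subtype_mk (h := hFr)).stronglyMeasurable
  refine ⟨fun η => WeakDual.toStrongDual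
      (hemb.isEmbedding.toHomeomorph.symm ⟨F η, hFr η⟩ : C).1,
    continuous_subtype_val.comp_stronglyMeasurable hsm, fun η => Subtype.property _,
    fun n A hA => ?_⟩
  rw [← (hFm n).2 A hA]
  congr 1
  ext η
  have h := hemb.isEmbedding.toHomeomorph.apply_symm_apply ⟨F η, hFr η⟩
  exact congrFun (congrArg Subtype.val h) n

/-- A dominated measure with values in the dual of a separable space has a weak* density. -/
lemma IsVMeasure.exists_density_of_separableSpace [IsFiniteMeasure μ]
    [TopologicalSpace.SeparableSpace X]
    (hm : IsVMeasure {A | MeasurableSet A} m) {c : ℝ} (hc : 0 ≤ c)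
    (hb : ∀ A, MeasurableSet A → ‖m A‖ ≤ c * μ.real A) :
    ∃ y : Ω → StrongDual 𝕜 X, StronglyMeasurable (fun η => StrongDual.toWeakDual (y η)) ∧
      ∀ A, MeasurableSet A → ∀ ξ : X,
        IntegrableOn (fun η => y η ξ) A μ ∧ m A ξ = ∫ η in A, y η ξ ∂μ := by
  have hdense := TopologicalSpace.denseRange_denseSeq X
  obtain ⟨y, hy, hyC, hym⟩ := hm.exists_weakDual_density_seq hb
    (WeakDual.isCompact_closedBall (𝕜 := 𝕜) (E := X) 0 c) (by simpa using hc)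
    (fun A hA h0 => average_mem_closedBall hb hA h0) (D := TopologicalSpace.denseSeq X)
    (fun s _ t _ hst => DFunLike.coe_injective <| hdense.equalizer
      (map_continuous s) (map_continuous t) (funext fun n => congrFun hst n))
  have hyc : ∀ η, ‖y η‖ ≤ c := fun η => by simpa using hyC η
  have hsm : ∀ ξ, StronglyMeasurable fun η => y η ξ := fun ξ =>
    (WeakDual.eval_continuous (𝕜 := 𝕜) ξ).comp_stronglyMeasurable hy
  have hint : ∀ ξ, Integrable (fun η => y η ξ) μ := fun ξ =>
    Integrable.of_bound (hsm ξ).aestronglyMeasurable (c * ‖ξ‖)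
      (Eventually.of_forall fun η => (y η).le_of_opNorm_le (hyc η) ξ)
  refine ⟨y, hy, fun A hA ξ => ⟨(hint ξ).integrableOn, ?_⟩⟩
  -- Both sides are continuous in `ξ`, so agreement on the dense sequence suffices.
  have hlip : LipschitzWith (c * μ.real A).toNNReal fun ξ => ∫ η in A, y η ξ ∂μ := by
    refine LipschitzWith.of_dist_le_mul fun ξ ζ => ?_
    rw [dist_eq_norm, dist_eq_norm, ← integral_sub (hint ξ).integrableOn.integrable
      (hint ζ).integrableOn.integrable, Real.coe_toNNReal _ (by positivity)]
    calc _ ≤ c * ‖ξ - ζ‖ * μ.real A :=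
          norm_setIntegral_le_of_norm_le_const (measure_lt_top _ _) fun η _ => by
            rw [← map_sub]; exact (y η).le_of_opNorm_le (hyc η) _
      _ = _ := by ring
  exact congrFun (hdense.equalizer (m A).continuous hlip.continuous
    (funext fun n => (hym n A hA).symm)) ξ

/-- For a dominated measure with values in the dual of a reflexive space, the unit ball is totally
bounded for uniform convergence on measurable sets. -/
lemma IsReflexiveSpace.exists_finset_approx [IsFiniteMeasure μ] (hX : IsReflexiveSpace 𝕜 X)
    (hm : IsVMeasure {A | MeasurableSet A} m) {c : ℝ} (hc : 0 ≤ c)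
    (hb : ∀ A, MeasurableSet A → ‖m A‖ ≤ c * μ.real A) {ε : ℝ} (hε : 0 < ε) :
    ∃ T : Finset X, ∀ ξ : X, ‖ξ‖ ≤ 1 → ∃ ζ ∈ T, ∀ A, MeasurableSet A → ‖m A (ξ - ζ)‖ ≤ ε := by
  classical
  by_contra! hcon
  have hsymm : Std.Symm fun ξ ζ : X => ∃ A, MeasurableSet A ∧ ε < ‖m A (ξ - ζ)‖ :=
    ⟨fun ξ ζ ⟨A, hA, h⟩ => ⟨A, hA, by rwa [← neg_sub, map_neg, norm_neg]⟩⟩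
  -- Failure of total boundedness yields a sequence in the unit ball, any two terms of which differ
  -- by more than `ε` on some measurable set.
  obtain ⟨D, hD1, hD2⟩ := exists_seq_of_forall_finset_exists' (fun ξ : X => ‖ξ‖ ≤ 1)
    (fun ξ ζ => ∃ A, MeasurableSet A ∧ ε < ‖m A (ξ - ζ)‖)
    (by
      intro T _
      obtain ⟨ξ, hξ, h⟩ := hcon T
      refine ⟨ξ, hξ, fun ζ hζ => ?_⟩
      obtain ⟨A, hA, h⟩ := h ζ hζ
      exact ⟨A, hA, by rwa [← neg_sub, map_neg, norm_neg]⟩)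
  obtain ⟨F, hF, hFC, hFm⟩ := hm.exists_density_seq hb
    (WeakDual.isCompact_closedBall (𝕜 := 𝕜) (E := X) 0 c) (by simpa using hc)
    (fun A hA h0 => average_mem_closedBall hb hA h0) D
  choose s hs hsF using hFC
  obtain ⟨φ, x, hφ, hlim⟩ := hX.exists_subseq_tendsto_apply D hD1
  have hFn : ∀ n, Measurable fun η => F η n := fun n => (measurable_pi_apply n).comp hF
  have hFb : ∀ η n, ‖F η n‖ ≤ c := fun η n => by
    rw [← hsF η]
    have h1 : ‖WeakDual.toStrongDual (s η)‖ ≤ c := by simpa using hs η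
    calc _ ≤ c * ‖D n‖ := (WeakDual.toStrongDual (s η)).le_of_opNorm_le h1 _
      _ ≤ c * 1 := by gcongr; exact hD1 n
      _ = c := mul_one c
  -- For fixed `η`, one functional `s η` represents all `F η n`, so weak convergence of `D ∘ φ` to
  -- `x` gives convergence at every `η`. Although `s` is not chosen measurably, `g` is measurable as
  -- a limit.
  set g : Ω → 𝕜 := fun η => s η x with hg
  have hFg : ∀ η, Tendsto (fun n => F η (φ n)) atTop (𝓝 (g η)) := fun η => by
    have := hlim (WeakDual.toStrongDual (s η))
    refine this.congr fun n => ?_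
    rw [← hsF η]; rfl
  have hgm : Measurable g := measurable_of_tendsto_metrizable (fun n => hFn (φ n))
    (tendsto_pi_nhds.2 hFg)
  have hgb : ∀ η, ‖g η‖ ≤ c := fun η =>
    le_of_tendsto (hFg η).norm (Eventually.of_forall fun n => hFb η (φ n))
  have hgi : Integrable g μ :=
    Integrable.of_bound hgm.aestronglyMeasurable c (Eventually.of_forall hgb)
  have hdct : Tendsto (fun n => ∫ η, ‖F η (φ n) - g η‖ ∂μ) atTop (𝓝 0) := by
    have := tendsto_integral_of_dominated_convergence (μ := μ)
      (F := fun n η => ‖F η (φ n) - g η‖) (f := fun _ => (0 : ℝ)) (fun _ => c + c)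
      (fun n => ((hFn (φ n)).sub hgm).norm.aestronglyMeasurable) (integrable_const _)
      (fun n => Eventually.of_forall fun η => by
        rw [norm_norm]
        exact (norm_sub_le _ _).trans (add_le_add (hFb _ _) (hgb _)))
      (Eventually.of_forall fun η => by
        simpa using (tendsto_iff_norm_sub_tendsto_zero.1 (hFg η)))
    simpa using this
  have hclose : ∀ n A, MeasurableSet A →
      ‖m A (D (φ n)) - ∫ η in A, g η ∂μ‖ ≤ ∫ η, ‖F η (φ n) - g η‖ ∂μ := by
    intro n A hA
    rw [← (hFm (φ n)).2 A hA, ← integral_sub (hFm (φ n)).1.integrableOn.integrable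
      hgi.integrableOn.integrable]
    refine (norm_integral_le_integral_norm _).trans ?_
    exact setIntegral_le_integral ((hFm (φ n)).1.sub hgi).norm
      (Eventually.of_forall fun _ => norm_nonneg _)
  obtain ⟨N, hN⟩ := eventually_atTop.1 (hdct.eventually (gt_mem_nhds (half_pos hε)))
  obtain ⟨A, hA, h⟩ := hD2 (hφ.injective.ne (Nat.succ_ne_self N))
  have h1 := hclose N A hA
  have h2 := hclose (N + 1) A hA
  have h3 := hN N le_rfl
  have h4 := hN (N + 1) (Nat.le_succ N)
  rw [map_sub] at h
  have h5 := norm_sub_le (m A (D (φ (N + 1))) - ∫ η in A, g η ∂μ)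
    (m A (D (φ N)) - ∫ η in A, g η ∂μ)
  rw [sub_sub_sub_cancel_right] at h5
  linarith

/-- A dominated measure with values in the dual of a reflexive space has separable range. -/
lemma IsReflexiveSpace.isSeparable_image [IsFiniteMeasure μ] (hX : IsReflexiveSpace 𝕜 X)
    (hm : IsVMeasure {A | MeasurableSet A} m) {c : ℝ} (hc : 0 ≤ c)
    (hb : ∀ A, MeasurableSet A → ‖m A‖ ≤ c * μ.real A) :
    TopologicalSpace.IsSeparable (m '' {A | MeasurableSet A}) := by
  choose T hT using fun k : ℕ => hX.exists_finset_approx hm hc hb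
    (ε := 1 / ((k : ℝ) + 1)) Nat.one_div_pos_of_nat
  -- Up to a small error `m A` is determined by its values on the finite set `T k`, and `T k → 𝕜` is
  -- separable.
  have hR : ∀ k, ∃ R : Set (Set Ω), R.Countable ∧ (∀ B ∈ R, MeasurableSet B) ∧ ∀ A, MeasurableSet A →
      ∃ B ∈ R, ∀ ζ ∈ T k, ‖m A ζ - m B ζ‖ ≤ 1 / ((k : ℝ) + 1) := by
    intro k
    let Ψ : Set Ω → T k → 𝕜 := fun A ζ => m A ζ
    obtain ⟨t, hts, htc, htd⟩ := (TopologicalSpace.IsSeparable.of_separableSpace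
      (Ψ '' {A | MeasurableSet A})).exists_countable_dense_subset
    have hpre : ∀ z : t, ∃ B, MeasurableSet B ∧ Ψ B = z := fun z => hts z.2
    choose B hBm hB using hpre
    have := htc.to_subtype
    refine ⟨Set.range B, Set.countable_range B, Set.forall_mem_range.2 hBm, fun A hA => ?_⟩
    obtain ⟨z, hz, hd⟩ := Metric.mem_closure_iff.1 (htd ⟨A, hA, rfl⟩) _
      (Nat.one_div_pos_of_nat (α := ℝ) (n := k))
    refine ⟨B ⟨z, hz⟩, ⟨_, rfl⟩, fun ζ hζ => ?_⟩
    have h1 := dist_le_pi_dist (Ψ A) z ⟨ζ, hζ⟩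
    have h2 : z = Ψ (B ⟨z, hz⟩) := (hB ⟨z, hz⟩).symm
    rw [h2, dist_eq_norm] at h1
    rw [h2] at hd
    exact h1.trans hd.le
  choose R hRc hRm hR using hR
  refine ⟨m '' ⋃ k, R k, (Set.countable_iUnion hRc).image m, ?_⟩
  rintro _ ⟨A, hA, rfl⟩
  rw [Metric.mem_closure_iff]
  intro ε hε
  -- Three errors: replacing `ξ` by `ζ` in `m A`, the same in `m B`, and comparing `m A` with `m B`
  -- at `ζ`.
  obtain ⟨k, hk⟩ := exists_nat_one_div_lt (show 0 < ε / 3 by linarith)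
  obtain ⟨B, hBR, hB⟩ := hR k A hA
  refine ⟨m B, ⟨B, Set.mem_iUnion.2 ⟨k, hBR⟩, rfl⟩, ?_⟩
  rw [dist_eq_norm]
  have hk0 : 0 < 1 / ((k : ℝ) + 1) := Nat.one_div_pos_of_nat
  refine (ContinuousLinearMap.opNorm_le_of_unit_norm (C := 3 * (1 / ((k : ℝ) + 1)))
    (by positivity) fun ξ hξ => ?_).trans_lt (by linarith)
  obtain ⟨ζ, hζ, h⟩ := hT k ξ hξ.le
  have h1 := h A hA
  have h2 := h B (hRm k B hBR)
  have h3 := hB ζ hζ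
  have h4 : (m A - m B) ξ = m A (ξ - ζ) + (m A ζ - m B ζ) - m B (ξ - ζ) := by
    simp only [sub_apply, map_sub]; ring
  rw [h4]
  have h5 := norm_sub_le (m A (ξ - ζ) + (m A ζ - m B ζ)) (m B (ξ - ζ))
  have h6 := norm_add_le (m A (ξ - ζ)) (m A ζ - m B ζ)
  linarith

/-- A dominated measure with values in the dual of a reflexive space has a strongly measurable
density with values in a separable closed subspace. -/
lemma IsReflexiveSpace.exists_density [IsFiniteMeasure μ] (hX : IsReflexiveSpace 𝕜 X)
    (hm : IsVMeasure {A | MeasurableSet A} m) {c : ℝ} (hc : 0 ≤ c)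
    (hb : ∀ A, MeasurableSet A → ‖m A‖ ≤ c * μ.real A) :
    ∃ (y : Ω → StrongDual 𝕜 X) (S : Submodule 𝕜 (StrongDual 𝕜 X)),
      TopologicalSpace.IsSeparable (S : Set (StrongDual 𝕜 X)) ∧
      IsClosed (S : Set (StrongDual 𝕜 X)) ∧ Set.range y ⊆ S ∧ StronglyMeasurable y ∧
      ∀ A, MeasurableSet A → ∀ ξ : X,
        IntegrableOn (fun η => y η ξ) A μ ∧ m A ξ = ∫ η in A, y η ξ ∂μ := by
  set S := (Submodule.span 𝕜 (m '' {A | MeasurableSet A})).topologicalClosure with hSdef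
  have hSc : IsClosed (S : Set (StrongDual 𝕜 X)) := Submodule.isClosed_topologicalClosure _
  have hSs : TopologicalSpace.IsSeparable (S : Set (StrongDual 𝕜 X)) := by
    rw [hSdef, Submodule.topologicalClosure_coe]
    exact ((hX.isSeparable_image hm hc hb).span (R := 𝕜)).closure
  have hmS : ∀ A, MeasurableSet A → m A ∈ S := fun A hA =>
    Submodule.le_topologicalClosure _ (Submodule.subset_span ⟨A, hA, rfl⟩)
  obtain ⟨D, hD⟩ := exists_seq_separating_of_isSeparable hSs
  have hD' : ∀ s ∈ S, ∀ t ∈ S, (∀ n, s (D n) = t (D n)) → s = t := fun s hs t ht h =>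
    sub_eq_zero.1 <| hD _ (S.sub_mem hs ht) fun n => by simp [h n]
  obtain ⟨y, hy, hyC, hym⟩ := hm.exists_weakDual_density_seq hb
    (hX.isCompact_inter_closedBall hSc c) ⟨S.zero_mem, by simpa using hc⟩
    (fun A hA h0 => ⟨S.smul_mem _ (hmS A hA), average_mem_closedBall hb hA h0⟩) (D := D)
    (fun s hs t ht hst => WeakDual.toStrongDual.injective <|
      hD' _ hs.1 _ ht.1 fun n => congrFun hst n)
  have hyS : ∀ η, y η ∈ S := fun η => (hyC η).1
  have hyc : ∀ η, ‖y η‖ ≤ c := fun η => by simpa using (hyC η).2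
  have : TopologicalSpace.SeparableSpace S := hSs.separableSpace
  have : SecondCountableTopology S := UniformSpace.secondCountable_of_separable S
  have : CompleteSpace S := hSc.completeSpace_coe
  borelize ↥S
  -- Lusin–Souslin: a continuous injection of the Polish space `S` is a Borel embedding, so
  -- measurability along `D` gives norm measurability.
  have hL : MeasurableEmbedding fun (s : S) (n : ℕ) => (s : StrongDual 𝕜 X) (D n) := by
    refine Continuous.measurableEmbedding (continuous_pi fun n => ?_) fun s t hst =>
      Subtype.ext <| hD' _ s.2 _ t.2 fun n => congrFun hst n
    exact (NormedSpace.inclusionInDoubleDual 𝕜 X (D n)).continuous.comp continuous_subtype_val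
  have hyS_meas : Measurable fun η => (⟨y η, hyS η⟩ : S) := by
    rw [← hL.measurable_comp_iff]
    exact measurable_pi_lambda _ fun n =>
      ((WeakDual.eval_continuous (𝕜 := 𝕜) (D n)).comp_stronglyMeasurable hy).measurable
  have hySm := hyS_meas.stronglyMeasurable
  have hyE : StronglyMeasurable y := continuous_subtype_val.comp_stronglyMeasurable hySm
  have hint : Integrable y μ :=
    Integrable.of_bound hyE.aestronglyMeasurable c (Eventually.of_forall hyc)
  refine ⟨y, S, hSs, hSc, Set.range_subset_iff.2 hyS, hyE, fun A hA ξ => ?_⟩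
  have he : ∀ ξ, ∫ η in A, y η ξ ∂μ = (∫ η in A, y η ∂μ) ξ := fun ξ =>
    (NormedSpace.inclusionInDoubleDual 𝕜 X ξ).integral_comp_comm hint.integrableOn.integrable
  refine ⟨((NormedSpace.inclusionInDoubleDual 𝕜 X ξ).integrable_comp hint).integrableOn, ?_⟩
  rw [he]
  -- Both `m A` and the Bochner integral of `y` lie in `S`, where agreement on `D` implies equality.
  refine DFunLike.congr_fun (hD' _ (hmS A hA) _
    (integral_mem_of_isClosed hSc hint.integrableOn.integrable hyS) fun n => ?_) ξ
  rw [← he, hym n A hA]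

/-- Densities of dominated measures with values in the dual of a reflexive or separable space. -/
lemma IsVMeasure.exists_density [IsFiniteMeasure μ]
    (hX : IsReflexiveSpace 𝕜 X ∨ TopologicalSpace.SeparableSpace X)
    (hm : IsVMeasure {A | MeasurableSet A} m) {c : ℝ} (hc : 0 ≤ c)
    (hb : ∀ A, MeasurableSet A → ‖m A‖ ≤ c * μ.real A) :
    ∃ (y : Ω → StrongDual 𝕜 X) (S : Submodule 𝕜 (StrongDual 𝕜 X)),
      TopologicalSpace.IsSeparable (S : Set (StrongDual 𝕜 X)) ∧
      IsClosed (S : Set (StrongDual 𝕜 X)) ∧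
      StronglyMeasurable (fun η => StrongDual.toWeakDual (y η)) ∧
      (∀ A, MeasurableSet A → ∀ ξ : X,
        IntegrableOn (fun η => y η ξ) A μ ∧ m A ξ = ∫ η in A, y η ξ ∂μ) ∧
      (IsReflexiveSpace 𝕜 X → Set.range y ⊆ S ∧ StronglyMeasurable y) := by
  by_cases hR : IsReflexiveSpace 𝕜 X
  · obtain ⟨y, S, hS, hSc, hyS, hy, h⟩ := hR.exists_density hm hc hb
    exact ⟨y, S, hS, hSc, NormedSpace.Dual.toWeakDual_continuous.comp_stronglyMeasurable hy, h,
      fun _ => ⟨hyS, hy⟩⟩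
  · have := hX.resolve_left hR
    obtain ⟨y, hy, h⟩ := hm.exists_density_of_separableSpace hc hb
    -- Nothing ties `S` to `y` without reflexivity, so the zero subspace serves.
    exact ⟨y, ⊥, by simpa using (Set.countable_singleton 0).isSeparable, by simp, hy, h,
      fun h => absurd h hR⟩

end DominatedDensity

/-! ### Maximal disjoint families and exhaustion. -/

section Exhaustion

/-- Zorn's lemma. Maximality is phrased as membership because `P ∅` is allowed; a set disjoint from
all members is then disjoint from itself, hence empty. -/
lemma exists_maximal_pairwiseDisjoint {Ω : Type*} (P : Set Ω → Prop) :
    ∃ 𝒞 : Set (Set Ω), (∀ C ∈ 𝒞, P C) ∧ 𝒞.PairwiseDisjoint id ∧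
      ∀ B, P B → (∀ C ∈ 𝒞, Disjoint B C) → B ∈ 𝒞 := by
  obtain ⟨𝒞, h𝒞⟩ := zorn_subset {𝒞 : Set (Set Ω) | (∀ C ∈ 𝒞, P C) ∧ 𝒞.PairwiseDisjoint id}
    fun c hc hcc => by
      refine ⟨⋃₀ c, ⟨?_, ?_⟩, fun s hs => Set.subset_sUnion_of_mem hs⟩
      · rintro C ⟨s, hs, hC⟩
        exact (hc hs).1 C hC
      · exact (Set.pairwiseDisjoint_sUnion hcc.directedOn).2 fun s hs => (hc hs).2
  refine ⟨𝒞, h𝒞.prop.1, h𝒞.prop.2, fun B hB hd => ?_⟩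
  have hins : insert B 𝒞 ∈ {𝒞 : Set (Set Ω) | (∀ C ∈ 𝒞, P C) ∧ 𝒞.PairwiseDisjoint id} :=
    ⟨Set.forall_mem_insert.2 ⟨hB, h𝒞.prop.1⟩, h𝒞.prop.2.insert fun C hC _ => hd C hC⟩
  exact h𝒞.le_of_ge hins (Set.subset_insert B 𝒞) (Set.mem_insert B 𝒞)

variable {Ω : Type*} [MeasurableSpace Ω] {μ : Measure Ω}

/-- If each nonnull part of `E` contains a nonnull set with property `P`, then finite disjoint
families of such sets exhaust `E` in measure. -/
lemma exists_finset_exhaustion {E : Set Ω} (hE : MeasurableSet E) (hEfin : μ E < ∞)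
    (P : Set Ω → Prop)
    (hP : ∀ B ⊆ E, MeasurableSet B → 0 < μ B → ∃ C ⊆ B, MeasurableSet C ∧ 0 < μ C ∧ P C)
    {δ : ℝ≥0∞} (hδ : 0 < δ) :
    ∃ T : Finset (Set Ω), (T : Set (Set Ω)).PairwiseDisjoint id ∧
      (∀ C ∈ T, C ⊆ E ∧ MeasurableSet C ∧ 0 < μ C ∧ P C) ∧ μ (E \ ⋃ C ∈ T, C) ≤ δ := by
  classical
  obtain ⟨𝒞, h𝒞, hd, hmax⟩ := exists_maximal_pairwiseDisjoint
    fun C => C ⊆ E ∧ MeasurableSet C ∧ 0 < μ C ∧ P C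
  have hcount : 𝒞.Countable := by
    have h := Measure.countable_meas_pos_of_disjoint_of_meas_iUnion_ne_top (μ := μ)
      (As := fun C : 𝒞 => (C : Set Ω)) (fun C => (h𝒞 C C.2).2.1)
      (fun C D hCD => hd C.2 D.2 (Subtype.coe_injective.ne hCD))
      ((measure_mono (Set.iUnion_subset fun C : 𝒞 => (h𝒞 C C.2).1)).trans_lt hEfin).ne
    rw [Set.eq_univ_of_forall (s := {C : 𝒞 | 0 < μ C}) fun C => (h𝒞 C C.2).2.2.1] at h
    exact Set.countable_coe_iff.1 (Set.countable_univ_iff.1 h)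
  have hU : MeasurableSet (⋃₀ 𝒞) := MeasurableSet.sUnion hcount fun C hC => (h𝒞 C hC).2.1
  have hnull : μ (E \ ⋃₀ 𝒞) = 0 := by
    by_contra h0
    obtain ⟨C, hCsub, hC, hCpos, hPC⟩ :=
      hP _ Set.sdiff_subset (hE.diff hU) (pos_iff_ne_zero.2 h0)
    have hdis : ∀ D ∈ 𝒞, Disjoint C D := fun D hD =>
      (Set.disjoint_sdiff_left.mono_right (Set.subset_sUnion_of_mem hD)).mono_left hCsub
    have hCe := hmax C ⟨hCsub.trans Set.sdiff_subset, hC, hCpos, hPC⟩ hdis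
    have := disjoint_self.1 (hdis C hCe)
    simp [this] at hCpos
  have hsub : ⋃₀ 𝒞 ⊆ E := Set.sUnion_subset fun C hC => (h𝒞 C hC).1
  have hsum : ∑' C : 𝒞, μ C = μ E := by
    rw [← measure_sUnion hcount hd fun C hC => (h𝒞 C hC).2.1]
    refine le_antisymm (measure_mono hsub) ?_
    calc μ E ≤ μ (⋃₀ 𝒞) + μ (E \ ⋃₀ 𝒞) := by
          have := measure_union_le (μ := μ) (⋃₀ 𝒞) (E \ ⋃₀ 𝒞)
          rwa [Set.union_sdiff_cancel hsub] at this
      _ = μ (⋃₀ 𝒞) := by rw [hnull, add_zero]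
  -- A finite subfamily carries more than `μ E - δ`, which is below `μ E` only if `μ E ≠ 0`.
  by_cases hE0 : μ E = 0
  · exact ⟨∅, by simp, by simp, by simp [hE0]⟩
  obtain ⟨T, hT⟩ := (ENNReal.summable (f := fun C : 𝒞 => μ C)).hasSum.eventually
    (lt_mem_nhds (b := ∑' C : 𝒞, μ C) (a := μ E - δ)
      (by rw [hsum]; exact ENNReal.sub_lt_self hEfin.ne hE0 hδ.ne')) |>.exists
  have hTmem : ∀ C ∈ T.map (Function.Embedding.subtype _), C ∈ 𝒞 := fun C hC => by
    obtain ⟨D, -, rfl⟩ := Finset.mem_map.1 hC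
    exact D.2
  refine ⟨T.map (Function.Embedding.subtype _), hd.subset hTmem,
    fun C hC => h𝒞 C (hTmem C hC), ?_⟩
  have hmeas : μ (⋃ C ∈ T.map (Function.Embedding.subtype _), C) = ∑ C ∈ T, μ C := by
    rw [measure_biUnion_finset (f := fun C => C) (hd.subset hTmem) fun C hC => (h𝒞 C (hTmem C hC)).2.1,
      Finset.sum_map]
    rfl
  rw [measure_sdiff (Set.iUnion₂_subset fun C hC => (h𝒞 C (hTmem C hC)).1)
    (Finset.measurableSet_biUnion _ fun C hC => (h𝒞 C (hTmem C hC)).2.1).nullMeasurableSet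
    (by rw [hmeas]; exact (lt_of_le_of_lt (ENNReal.sum_le_tsum T) (hsum ▸ hEfin)).ne), hmeas]
  exact tsub_le_iff_tsub_le.1 hT.le

end Exhaustion

/-! ### Gluing over countably many pieces. -/

section Gluing

/-- Gluing strongly measurable functions on countably many disjoint sets of finite measure. -/
lemma finStronglyMeasurable_of_countable_cover {Ω E ι : Type*} [MeasurableSpace Ω]
    {μ : Measure Ω} [AddCommMonoid E] [TopologicalSpace E] [Countable ι] {A : ι → Set Ω}
    (hA : ∀ i, MeasurableSet (A i)) (hfin : ∀ i, μ (A i) < ∞)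
    (hd : Pairwise (Function.onFun Disjoint A)) {f : ι → Ω → E}
    (hf : ∀ i, StronglyMeasurable (f i)) {y : Ω → E} (hy : ∀ i, ∀ η ∈ A i, y η = f i η)
    (hy0 : ∀ η, (∀ i, η ∉ A i) → y η = 0) : FinStronglyMeasurable y μ := by
  classical
  choose F hF using hf
  obtain ⟨e, he⟩ := exists_injective_nat ι
  have hs : ∀ n, {i | e i < n}.Finite := fun n =>
    (Set.finite_lt_nat n).preimage he.injOn
  -- Only the finitely many pieces numbered below `n` enter, so supports have finite measure; on `A
  -- j` the sum is `F j n` once `n > e j`.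
  let G : ℕ → SimpleFunc Ω E := fun n => ∑ i ∈ (hs n).toFinset, (F i n).restrict (A i)
  have hG : ∀ n η, G n η = ∑ i ∈ (hs n).toFinset, (A i).indicator (F i n) η := fun n η => by
    simp only [G]
    induction (hs n).toFinset using Finset.induction_on with
    | empty => simp
    | insert a s ha ih =>
      rw [Finset.sum_insert ha, Finset.sum_insert ha, SimpleFunc.add_apply, ih,
        SimpleFunc.restrict_apply _ (hA a)]
  refine ⟨G, fun n => ?_, fun η => ?_⟩
  · have hsub : Function.support (G n) ⊆ ⋃ i ∈ (hs n).toFinset, A i := by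
      intro η hη
      by_contra hn
      simp only [Set.mem_iUnion, not_exists] at hn
      refine hη ?_
      rw [hG]
      exact Finset.sum_eq_zero fun i hi => Set.indicator_of_notMem (hn i hi) _
    refine (measure_mono hsub).trans_lt ((measure_biUnion_finset_le _ _).trans_lt ?_)
    exact ENNReal.sum_lt_top.2 fun i _ => hfin i
  · by_cases h : ∃ j, η ∈ A j
    · obtain ⟨j, hj⟩ := h
      rw [hy j η hj]
      refine (hF j η).congr' ?_
      filter_upwards [eventually_gt_atTop (e j)] with n hn
      rw [hG, Finset.sum_eq_single j (fun i _ hij => Set.indicator_of_notMem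
        (Set.disjoint_left.1 (hd hij.symm) hj) _) (fun hj' => absurd (by simpa using hn) hj'),
        Set.indicator_of_mem hj]
    · push Not at h
      rw [hy0 η h]
      refine tendsto_const_nhds.congr fun n => ?_
      rw [hG]
      exact (Finset.sum_eq_zero fun i _ => Set.indicator_of_notMem (h i) _).symm

end Gluing

/-! ### Consequences of bounded variation. -/

section BoundedVariation

variable {Ω 𝕜 X : Type*} [MeasurableSpace Ω] [RCLike 𝕜]
  [NormedAddCommGroup X] [NormedSpace 𝕜 X] {μ : Measure Ω} {m : Set Ω → X}

lemma IsAbsContVMeasure.eq_zero_of_measure_eq_zero {𝓡 : Set (Set Ω)}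
    (hac : IsAbsContVMeasure μ 𝓡 m) {A : Set Ω} (hA : MeasurableSet A) (h0 : μ A = 0) :
    m A = 0 := by
  by_contra hne
  obtain ⟨δ, -, h⟩ := hac.small _ (isOpen_ne.mem_nhds (Ne.symm hne) : {x | x ≠ m A} ∈ 𝓝 (0 : X))
  exact (h A hA (by simp [h0])).2 rfl

/-- The norm is a bounded seminorm, and the only one the proof needs. -/
lemma HasBoundedVariation.exists_norm_bound {q : ℝ} {𝓡 : Set (Set Ω)}
    (hv : HasBoundedVariation 𝕜 μ q 𝓡 m) : ∃ M : ℝ, 0 ≤ M ∧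
      ∀ T : Finset (Set Ω), (T : Set (Set Ω)).PairwiseDisjoint id →
        (∀ A ∈ T, MeasurableSet A ∧ 0 < μ A ∧ μ A < ∞) →
        ∑ A ∈ T, (μ.real A) ^ (1 - q) * ‖m A‖ ^ q ≤ M :=
  hv.bounded (normSeminorm 𝕜 X) fun B hB => by
    obtain ⟨r, hr⟩ := isBounded_iff_forall_norm_le.1 ((NormedSpace.isVonNBounded_iff 𝕜).1 hB)
    exact ⟨r, Set.forall_mem_image.2 hr⟩

/-- Bounded variation forces every nonnull set to contain a nonnull set on which `m` is dominated
by a multiple of `μ`. -/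
lemma HasBoundedVariation.exists_subset_dominated {q : ℝ} {𝓡 : Set (Set Ω)}
    (hv : HasBoundedVariation 𝕜 μ q 𝓡 m) (hac : IsAbsContVMeasure μ 𝓡 m)
    {E : Set Ω} (hE : MeasurableSet E) (hpos : 0 < μ E) (hfin : μ E < ∞) :
    ∃ B ⊆ E, MeasurableSet B ∧ 0 < μ B ∧
      ∃ n : ℕ, ∀ A ⊆ B, MeasurableSet A → ‖m A‖ ≤ n * μ.real A := by
  by_contra! hcon
  obtain ⟨M, hM0, hM⟩ := hv.exists_norm_bound
  have hq := hv.one_le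
  have hEr : 0 < μ.real E := ENNReal.toReal_pos hpos.ne' hfin.ne
  -- `n ≥ 1` gives `n ≤ n ^ q`. Sets with `‖m C‖ > n * μ.real C` filling half of `E` then contribute
  -- at least `n * μ.real E / 2 > M`.
  obtain ⟨n, hn⟩ := exists_nat_gt (max 1 (2 * M / μ.real E))
  have hn1 : (1 : ℝ) ≤ n := (le_max_left _ _).trans hn.le
  obtain ⟨T, hTd, hT, hTδ⟩ := exists_finset_exhaustion hE hfin
    (fun C => (n : ℝ) * μ.real C < ‖m C‖) (fun B hBE hB hB0 => by
      obtain ⟨C, hCB, hC, hlt⟩ := hcon B hBE hB hB0 n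
      refine ⟨C, hCB, hC, pos_iff_ne_zero.2 fun h0 => ?_, hlt⟩
      rw [hac.eq_zero_of_measure_eq_zero hC h0, norm_zero] at hlt
      exact absurd hlt (not_lt.2 (by positivity))) (ENNReal.half_pos hpos.ne')
  have hTfin : ∀ C ∈ T, μ C < ∞ := fun C hC => (measure_mono (hT C hC).1).trans_lt hfin
  have h1 := hM T hTd fun C hC => ⟨(hT C hC).2.1, (hT C hC).2.2.1, hTfin C hC⟩
  have h2 : ∀ C ∈ T, n * μ.real C ≤ (μ.real C) ^ (1 - q) * ‖m C‖ ^ q := fun C hC => by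
    have hCr : 0 < μ.real C := ENNReal.toReal_pos (hT C hC).2.2.1.ne' (hTfin C hC).ne
    calc n * μ.real C ≤ (n : ℝ) ^ q * μ.real C := by
          gcongr
          exact Real.self_le_rpow_of_one_le hn1 hq
      _ = (μ.real C) ^ (1 - q) * (n * μ.real C) ^ q := by
          rw [Real.mul_rpow (by positivity) hCr.le, mul_left_comm, ← Real.rpow_add hCr]
          simp
      _ ≤ _ := by
          gcongr
          exact (hT C hC).2.2.2.le
  have h3 : n * ∑ C ∈ T, μ.real C ≤ M := by
    rw [Finset.mul_sum]
    exact (Finset.sum_le_sum h2).trans h1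
  have hUE : (⋃ C ∈ T, C) ⊆ E := Set.iUnion₂_subset fun C hC => (hT C hC).1
  have h4 : μ.real (⋃ C ∈ T, C) = ∑ C ∈ T, μ.real C :=
    measureReal_biUnion_finset hTd (fun C hC => (hT C hC).2.1) fun C hC => (hTfin C hC).ne
  have h5 : μ.real (E \ ⋃ C ∈ T, C) ≤ μ.real E / 2 := by
    have := ENNReal.toReal_mono (ENNReal.div_lt_top hfin.ne (by simp)).ne hTδ
    rwa [ENNReal.toReal_div] at this
  have h6 : μ.real E ≤ μ.real (⋃ C ∈ T, C) + μ.real (E \ ⋃ C ∈ T, C) := by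
    have := measureReal_union_le (μ := μ) (⋃ C ∈ T, C) (E \ ⋃ C ∈ T, C)
    rwa [Set.union_sdiff_cancel hUE] at this
  have h7 : 2 * M / μ.real E < n := (le_max_right _ _).trans_lt hn
  rw [div_lt_iff₀ hEr] at h7
  have h8 : (n : ℝ) * (μ.real E / 2) ≤ n * ∑ C ∈ T, μ.real C := by
    gcongr
    linarith
  linarith

/-- If `m` vanishes on each subset of `E` on which it is dominated, then `m E = 0`. -/
lemma HasBoundedVariation.eq_zero_of_dominated {q : ℝ}
    (hv : HasBoundedVariation 𝕜 μ q {A | MeasurableSet A ∧ μ A < ∞} m)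
    (hac : IsAbsContVMeasure μ {A | MeasurableSet A ∧ μ A < ∞} m)
    {E : Set Ω} (hE : MeasurableSet E) (hfin : μ E < ∞)
    (h0 : ∀ B ⊆ E, MeasurableSet B → 0 < μ B →
      (∃ n : ℕ, ∀ A ⊆ B, MeasurableSet A → ‖m A‖ ≤ n * μ.real A) → m B = 0) : m E = 0 := by
  by_contra hne
  -- Removing finitely many dominated pieces, on which `m` is zero, leaves the value `m E` on a set
  -- of measure at most `δ`, contrary to the choice of `δ`.
  obtain ⟨δ, hδ, h⟩ := hac.small _ (isOpen_ne.mem_nhds (Ne.symm hne) : {x | x ≠ m E} ∈ 𝓝 (0 : X))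
  obtain ⟨T, hTd, hT, hTδ⟩ := exists_finset_exhaustion hE hfin
    (fun B => ∃ n : ℕ, ∀ A ⊆ B, MeasurableSet A → ‖m A‖ ≤ n * μ.real A)
    (fun B hBE hB hB0 => hv.exists_subset_dominated hac hB hB0
      ((measure_mono hBE).trans_lt hfin)) (ENNReal.ofReal_pos.2 hδ)
  have hTR : ∀ C ∈ T, C ∈ {A | MeasurableSet A ∧ μ A < ∞} := fun C hC =>
    ⟨(hT C hC).2.1, (measure_mono (hT C hC).1).trans_lt hfin⟩
  have hU := hac.isVMeasure.biUnion_mem T id hTR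
  have hUE : (⋃ C ∈ T, C) ⊆ E := Set.iUnion₂_subset fun C hC => (hT C hC).1
  refine (h _ (hE.diff hU.1) hTδ).2 ?_
  have h1 := hac.isVMeasure.map_diff ⟨hE, hfin⟩ hU hUE
  rw [hac.isVMeasure.map_biUnion T id hTR hTd, Finset.sum_eq_zero (f := fun C => m (id C)) fun C hC =>
    h0 C (hT C hC).1 (hT C hC).2.1 (hT C hC).2.2.1 (hT C hC).2.2.2, sub_zero] at h1
  exact h1

/-- A disjoint family of sets on which `m` does not vanish is countable. -/
lemma HasBoundedVariation.countable_of_ne_zero {q : ℝ} {𝓡 : Set (Set Ω)}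
    (hv : HasBoundedVariation 𝕜 μ q 𝓡 m) {𝒜 : Set (Set Ω)} (hd : 𝒜.PairwiseDisjoint id)
    (h𝒜 : ∀ A ∈ 𝒜, MeasurableSet A ∧ 0 < μ A ∧ μ A < ∞) (hne : ∀ A ∈ 𝒜, m A ≠ 0) :
    𝒜.Countable := by
  obtain ⟨M, -, hM⟩ := hv.exists_norm_bound
  -- A summable family has countable support, and here every term is positive. This replaces
  -- σ-finiteness of `μ`.
  have hs : Summable fun A : 𝒜 => (μ.real (A : Set Ω)) ^ (1 - q) * ‖m A‖ ^ q := by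
    refine summable_of_sum_le (c := M) (fun A => by positivity) fun T => ?_
    have hTmem : ∀ C ∈ T.map (Function.Embedding.subtype _), C ∈ 𝒜 := fun C hC => by
      obtain ⟨D, -, rfl⟩ := Finset.mem_map.1 hC
      exact D.2
    have := hM (T.map (Function.Embedding.subtype _)) (hd.subset hTmem)
      fun C hC => h𝒜 C (hTmem C hC)
    rwa [Finset.sum_map] at this
  have hsupp := hs.countable_support
  rw [Set.eq_univ_of_forall (s := Function.support _) fun A : 𝒜 => by
    have h1 : 0 < μ.real (A : Set Ω) :=
      ENNReal.toReal_pos (h𝒜 A A.2).2.1.ne' (h𝒜 A A.2).2.2.ne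
    have h2 : 0 < ‖m A‖ := norm_pos_iff.2 (hne A A.2)
    exact Function.mem_support.2 (by positivity)] at hsupp
  exact Set.countable_coe_iff.1 (Set.countable_univ_iff.1 hsupp)

end BoundedVariation

/-! ### Localization and the Pettis property. -/

section Localization

variable {Ω 𝕜 X : Type*} [MeasurableSpace Ω] [RCLike 𝕜]
  [NormedAddCommGroup X] [NormedSpace 𝕜 X] {μ : Measure Ω} {m : Set Ω → StrongDual 𝕜 X}

/-- A measure that is dominated on a set of finite measure has a density there. -/
lemma IsVMeasure.exists_density_on (hX : IsReflexiveSpace 𝕜 X ∨ TopologicalSpace.SeparableSpace X)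
    (hm : IsVMeasure {A | MeasurableSet A ∧ μ A < ∞} m) {B : Set Ω} (hB : MeasurableSet B)
    (hBfin : μ B < ∞) {c : ℝ} (hc : 0 ≤ c)
    (hb : ∀ A ⊆ B, MeasurableSet A → ‖m A‖ ≤ c * μ.real A) :
    ∃ y : Ω → StrongDual 𝕜 X, StronglyMeasurable (fun η => StrongDual.toWeakDual (y η)) ∧
      (∀ A ⊆ B, MeasurableSet A → ∀ ξ : X,
        IntegrableOn (fun η => y η ξ) A μ ∧ m A ξ = ∫ η in A, y η ξ ∂μ) ∧
      (IsReflexiveSpace 𝕜 X → StronglyMeasurable y) := by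
  have : IsFiniteMeasure (μ.restrict B) := ⟨by simpa using hBfin⟩
  have hmem : ∀ A, MeasurableSet A → A ∩ B ∈ {A | MeasurableSet A ∧ μ A < ∞} := fun A hA =>
    ⟨hA.inter hB, (measure_mono Set.inter_subset_right).trans_lt hBfin⟩
  -- Intersecting with `B` extends the domain to all measurable sets, with domination by the finite
  -- measure `μ.restrict B`.
  have hm' : IsVMeasure {A | MeasurableSet A} fun A => m (A ∩ B) :=
    { empty_mem := MeasurableSet.empty
      union_mem := fun A hA C hC => MeasurableSet.union hA hC
      diff_mem := fun A hA C hC => MeasurableSet.diff hA hC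
      map_empty := by simpa using hm.map_empty
      map_union := fun A hA C hC h => by
        rw [Set.union_inter_distrib_right]
        exact hm.map_union _ (hmem A hA) _ (hmem C hC)
          (h.mono Set.inter_subset_left Set.inter_subset_left) }
  obtain ⟨y, S, -, -, hy, hd, hr⟩ := hm'.exists_density (μ := μ.restrict B) hX hc fun A hA => by
    rw [measureReal_restrict_apply hA]
    exact hb _ Set.inter_subset_right (hA.inter hB)
  refine ⟨y, hy, fun A hAB hA ξ => ?_, fun h => (hr h).2⟩
  have h := hd A hA ξ
  rwa [IntegrableOn, Measure.restrict_restrict_of_subset hAB,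
    Set.inter_eq_self_of_subset_left hAB] at h

/-- Weak* continuous functionals are evaluations at vectors, so the Pettis condition is the density
identity; evaluations also give uniqueness. -/
lemma isPettis_toWeakDual {y : Ω → StrongDual 𝕜 X}
    (h : ∀ A, MeasurableSet A → ∀ ξ : X,
      IntegrableOn (fun η => y η ξ) A μ ∧ m A ξ = ∫ η in A, y η ξ ∂μ) :
    IsPettis 𝕜 μ (fun η => StrongDual.toWeakDual (y η)) := by
  intro A hA
  refine ⟨StrongDual.toWeakDual (m A), fun u => ?_, fun x hx => ?_⟩
  · obtain ⟨ξ, rfl⟩ := LinearMap.dualEmbedding_surjective (topDualPairing 𝕜 X) u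
    exact ⟨(h A hA ξ).1, (h A hA ξ).2.symm⟩
  · refine DFunLike.ext _ _ fun ξ => ?_
    exact ((hx (WeakBilin.eval (topDualPairing 𝕜 X) ξ)).2.symm).trans (h A hA ξ).2.symm

end Localization

theorem proposition71 {Ω 𝕜 X : Type*} [MeasurableSpace Ω] [RCLike 𝕜]
    [NormedAddCommGroup X] [NormedSpace 𝕜 X] [CompleteSpace X]
    (hX : IsReflexiveSpace 𝕜 X ∨ TopologicalSpace.SeparableSpace X)
    (μ : Measure Ω) (m : Set Ω → StrongDual 𝕜 X) :
    -- the case of a finite measure that dominates the norm of `m`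
    (μ Set.univ < ∞ →
      IsVMeasure {A | MeasurableSet A} m →
      (∀ A, MeasurableSet A → ‖m A‖ ≤ μ.real A) →
      ∃ (y : Ω → StrongDual 𝕜 X) (S : Submodule 𝕜 (StrongDual 𝕜 X)),
        TopologicalSpace.IsSeparable (S : Set (StrongDual 𝕜 X)) ∧
        IsClosed (S : Set (StrongDual 𝕜 X)) ∧
        IsSimplyMeasurable μ (fun η => StrongDual.toWeakDual (y η)) ∧
        IsPettis 𝕜 μ (fun η => StrongDual.toWeakDual (y η)) ∧
        (∀ A, MeasurableSet A → ∀ ξ : X,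
          IntegrableOn (fun η => y η ξ) A μ ∧ m A ξ = ∫ η in A, y η ξ ∂μ) ∧
        (IsReflexiveSpace 𝕜 X → Set.range y ⊆ S ∧ IsSimplyMeasurable μ y)) ∧
    -- the case of an arbitrary positive measure and bounded `μ`-`q` variation
    (∀ q : ℝ, 1 ≤ q →
      IsVMeasure {A | MeasurableSet A ∧ μ A < ∞} m →
      IsAbsContVMeasure μ {A | MeasurableSet A ∧ μ A < ∞} m →
      HasBoundedVariation 𝕜 μ q {A | MeasurableSet A ∧ μ A < ∞} m →
      ∃ (𝒜 : Set (Set Ω)) (y : Ω → StrongDual 𝕜 X),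
        𝒜.Countable ∧ 𝒜.PairwiseDisjoint id ∧
        (∀ A ∈ 𝒜, MeasurableSet A ∧ 0 < μ A ∧ μ A < ∞) ∧
        IsSimplyMeasurable μ (fun η => StrongDual.toWeakDual (y η)) ∧
        (∀ η, η ∉ ⋃₀ 𝒜 → y η = 0) ∧
        (∀ A, MeasurableSet A → μ A < ∞ → ⋃₀ 𝒜 ∩ A = ∅ → m A = 0) ∧
        (∀ A, MeasurableSet A → μ A < ∞ → ∀ A₁ ∈ 𝒜, A ⊆ A₁ → ∀ ξ : X,
          IntegrableOn (fun η => y η ξ) A μ ∧ m A ξ = ∫ η in A, y η ξ ∂μ) ∧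
        (IsReflexiveSpace 𝕜 X → IsSimplyMeasurable μ y)) := by
  refine ⟨fun hμ hm hb => ?_, fun q _ hm hac hv => ?_⟩
  · have : IsFiniteMeasure μ := ⟨hμ⟩
    obtain ⟨y, S, hS, hSc, hy, hd, hr⟩ := hm.exists_density (μ := μ) hX zero_le_one
      fun A hA => by rw [one_mul]; exact hb A hA
    exact ⟨y, S, hS, hSc, hy.finStronglyMeasurable μ, isPettis_toWeakDual hd, hd,
      fun h => ⟨(hr h).1, (hr h).2.finStronglyMeasurable μ⟩⟩
  -- The condition `m B ≠ 0` secures countability. Dominated sets left outside the union then have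
  -- `m B = 0`, as `HasBoundedVariation.eq_zero_of_dominated` requires.
  · obtain ⟨𝒜, h𝒜, hdis, hmax⟩ := exists_maximal_pairwiseDisjoint fun B : Set Ω =>
      MeasurableSet B ∧ 0 < μ B ∧ μ B < ∞ ∧ m B ≠ 0 ∧
        ∃ n : ℕ, ∀ A ⊆ B, MeasurableSet A → ‖m A‖ ≤ n * μ.real A
    have hcount : 𝒜.Countable := hv.countable_of_ne_zero hdis
      (fun A hA => ⟨(h𝒜 A hA).1, (h𝒜 A hA).2.1, (h𝒜 A hA).2.2.1⟩) fun A hA => (h𝒜 A hA).2.2.2.1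
    have hloc : ∀ B : 𝒜, ∃ y : Ω → StrongDual 𝕜 X,
        StronglyMeasurable (fun η => StrongDual.toWeakDual (y η)) ∧
        (∀ A ⊆ (B : Set Ω), MeasurableSet A → ∀ ξ : X,
          IntegrableOn (fun η => y η ξ) A μ ∧ m A ξ = ∫ η in A, y η ξ ∂μ) ∧
        (IsReflexiveSpace 𝕜 X → StronglyMeasurable y) := fun B => by
      obtain ⟨hB, -, hBfin, -, n, hn⟩ := h𝒜 B B.2
      exact hm.exists_density_on hX hB hBfin n.cast_nonneg hn
    choose Y hYw hYd hYr using hloc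
    have hd : Pairwise (Function.onFun Disjoint fun B : 𝒜 => (B : Set Ω)) := fun B C hBC =>
      hdis B.2 C.2 (Subtype.coe_injective.ne hBC)
    classical
    let y : Ω → StrongDual 𝕜 X := fun η =>
      if h : ∃ B : 𝒜, η ∈ (B : Set Ω) then Y h.choose η else 0
    have hy : ∀ B : 𝒜, ∀ η ∈ (B : Set Ω), y η = Y B η := fun B η hη => by
      have h : ∃ B : 𝒜, η ∈ (B : Set Ω) := ⟨B, hη⟩
      have hB : h.choose = B := by
        by_contra hne
        exact Set.disjoint_left.1 (hd hne) h.choose_spec hη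
      simp only [y, dif_pos h, hB]
    have hy0 : ∀ η, (∀ B : 𝒜, η ∉ (B : Set Ω)) → y η = 0 := fun η hη =>
      dif_neg (not_exists.2 hη)
    have := hcount.to_subtype
    refine ⟨𝒜, y, hcount, hdis, fun A hA => ⟨(h𝒜 A hA).1, (h𝒜 A hA).2.1, (h𝒜 A hA).2.2.1⟩,
      ?_, fun η hη => hy0 η fun B hB => hη ⟨B, B.2, hB⟩, fun A hA hAfin hAd => ?_,
      fun A hA _ A₁ hA₁ hsub ξ => ?_, fun h => ?_⟩
    · exact finStronglyMeasurable_of_countable_cover (fun B : 𝒜 => (h𝒜 B B.2).1)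
        (fun B => (h𝒜 B B.2).2.2.1) hd hYw (fun B η hη => by rw [hy B η hη])
        fun η hη => by rw [hy0 η hη, map_zero]
    · refine hv.eq_zero_of_dominated hac hA hAfin fun B hBA hB hB0 hdom => ?_
      by_contra hne
      have hBd : ∀ C ∈ 𝒜, Disjoint B C := fun C hC =>
        ((Set.disjoint_iff_inter_eq_empty.2 hAd).mono (Set.subset_sUnion_of_mem hC) hBA).symm
      have hB𝒜 := hmax B ⟨hB, hB0, (measure_mono hBA).trans_lt hAfin, hne, hdom⟩ hBd
      exact hne (by rw [show B = ∅ from disjoint_self.1 (hBd B hB𝒜), hm.map_empty])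
    · have hEq : Set.EqOn (fun η => y η ξ) (fun η => Y ⟨A₁, hA₁⟩ η ξ) A := fun η hη => by
        simp only [hy ⟨A₁, hA₁⟩ η (hsub hη)]
      rw [integrableOn_congr_fun hEq hA, setIntegral_congr_fun hA hEq]
      exact hYd ⟨A₁, hA₁⟩ A hsub hA ξ
    · exact finStronglyMeasurable_of_countable_cover (fun B : 𝒜 => (h𝒜 B B.2).1)
        (fun B => (h𝒜 B B.2).2.2.1) hd (fun B => hYr B h) hy hy0
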